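/- Conventions. Let $K$ be an algebraically closed field and $A=\bigoplus_{i\ge 0}A_i$ a finite-dimensional unital positively graded $K$-algebra. Graded modules are finite-dimensional $\mathbb Z$-graded left $A$-modules; $M\langle k\rangle_d:=M_{d-k}$; $\simeq$ denotes an isomorphism of degree $0$; $A\text{-gmod}$ is the category of graded modules with homomorphisms of degree $0$. Let $\star$ be a $K$-linear homogeneous anti-involution of $A$ of degree $0$, and for a graded module $M$ let $M^{\circledast}$ be the graded module with $M^{\circledast}_j=\operatorname{Hom}_K(M_{-j},K)$ and $(af)(m)=f(a^\star m)$. Let $\{L^\lambda\mid\lambda\in\Lambda\}$ ($\Lambda$ finite) be a complete set of pairwise non-isomorphic simple $A$-modules, each graded by being concentrated in degree $0$. Let $P^\lambda$ be the projective cover of $L^\lambda$, graded so that $P^\lambda\to L^\lambda$ has degree $0$, and let $d_\lambda$ be the largest integer with $P^\lambda_{d_\lambda}\neq 0$. Let $\Lambda_0=\{\lambda\in\Lambda\mid P^\lambda\text{ is injective}\}$. The graded length of $M=\bigoplus_{i=a}^bM_i$ with $M_a\ne0\ne M_b$ is $b-a+1$. The pair $(A,\star)$ is a graded cellular algebra if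 there are a poset $X$, finite sets $T(x)$ ($x\in X$), functions $\deg:T(x)\to\mathbb Z$ and a $K$-basis $\{c^x_{st}\mid x\in X,\ s,t\in T(x)\}$ of $A$ such that $c^x_{st}$ is homogeneous of degree $\deg s+\deg t$; $(c^x_{st})^\star=c^x_{ts}$; and for all $x\in X$, $t\in T(x)$, $a\in A$ there are scalars $r_v\in K$ ($v\in T(x)$), independent of $s$, with $c^x_{st}a\equiv\sum_{v}r_v c^x_{sv}$ modulo the span of all $c^y_{uw}$ with $y>x$, for every $s\in T(x)$. The category $A\text{-gmod}$ is a graded highest weight category with duality functor $\circledast$ if there are a partial order on $\Lambda$ and graded modules $\Delta^\lambda$ ($\lambda\in\Lambda$) such that: (i) $\Delta^\lambda/\operatorname{rad}\Delta^\lambda\simeq L^\lambda$, $(L^\lambda)^\circledast\simeq L^\lambda$, and $\{L^\lambda\langle k\rangle\mid\lambda\in\Lambda,\ k\in\mathbb Z\}$ is a complete set of pairwise non-isomorphic simple objects of $A\text{-gmod}$; (ii) if $\operatorname{Hom}_{A\text{-gmod}}(\Delta^\lambda\langle k\rangle,M)=0$ for all $\lambda\in\Lambda$ and $k\in\mathbb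 Z$, then $M=0$; (iii) for each $\lambda$ there are an indecomposable graded projective module and a surjection of degree $0$ from it onto $\Delta^\lambda$ whose kernel has a finite filtration in $A\text{-gmod}$ with successive quotients of the form $\Delta^\mu\langle k\rangle$, $\mu>\lambda$, $k\in\mathbb Z$; (iv) $\operatorname{End}_{A\text{-gmod}}(\Delta^\lambda)\cong K$; (v) if $\operatorname{Hom}_{A\text{-gmod}}(\Delta^\lambda,\Delta^\mu)\neq0$, then $\lambda\le\mu$. Proposition. Assume that $\operatorname{soc}(P^\lambda)\simeq L^\lambda\langle d_\lambda\rangle$ for all $\lambda\in\Lambda_0$, and that either $(A,\star)$ is a graded cellular algebra or $A\text{-gmod}$ is a graded highest weight category with duality functor $\circledast$. Assume further that there is a homogeneous idempotent $e\in A$ of degree $0$ with $e^\star=e$ and $Ae\simeq\bigoplus_{\lambda\in\Lambda_0}P^\lambda$, such that the canonical map from $A$ to the ring of additive endomorphisms of $Ae$ commuting with $\operatorname{End}_A(Ae)$ is an isomorphism. Then for all $\lambda,\mu\in\Lambda_0$ such that $L^\lambda$ and $L^\mu$ belong to the same block of $A$, we have $d_\lambda=d_\mu$, and hence $P^\lambda$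 and $P^\mu$ have the same graded length. -/

import Mathlib

universe u

section

variable {K A : Type u} [Field K] [Ring A] [Algebra K A]

/-- A graded (left) module, finite-dimensional over `K`, over the graded algebra `A = ⨁ 𝒜 i`. These
are the objects of the category `A-gmod`; its morphisms are the `A`-linear maps of degree `0`. -/
structure GradedMod (𝒜 : ℤ → Submodule K A) where
  carrier : Type u
  [addCommGroup : AddCommGroup carrier]
  [moduleK : Module K carrier]
  [moduleA : Module A carrier]
  [tower : IsScalarTower K A carrier]
  [finite : FiniteDimensional K carrier]
  deg : ℤ → Submodule K carrier
  isInternal : DirectSum.IsInternal deg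
  smul_mem : ∀ {i j : ℤ} {a : A} {x : carrier}, a ∈ 𝒜 i → x ∈ deg j → a • x ∈ deg (i + j)

/-- A `K`-linear homogeneous anti-involution of degree `0` on the graded algebra `A`. -/
structure GradedAntiInvolution (𝒜 : ℤ → Submodule K A) where
  toLinearMap : A →ₗ[K] A
  map_mul : ∀ a b : A, toLinearMap (a * b) = toLinearMap b * toLinearMap a
  involutive : ∀ a : A, toLinearMap (toLinearMap a) = a
  map_mem : ∀ {i : ℤ} {a : A}, a ∈ 𝒜 i → toLinearMap a ∈ 𝒜 i

instance (𝒜 : ℤ → Submodule K A) : CoeFun (GradedAntiInvolution 𝒜) (fun _ => A → A) :=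
  ⟨fun s => s.toLinearMap⟩

theorem GradedAntiInvolution.map_one {𝒜 : ℤ → Submodule K A} (star : GradedAntiInvolution 𝒜) :
    star 1 = 1 := by
  have h := star.map_mul (star 1) 1
  rw [mul_one, star.involutive, mul_one] at h
  exact h.symm

namespace GradedMod

variable {𝒜 : ℤ → Submodule K A}

instance : CoeSort (GradedMod 𝒜) (Type u) := ⟨carrier⟩

attribute [instance] addCommGroup moduleK moduleA tower finite

/-! ### Degree-zero morphisms, shifts, sizes -/

/-- `f` is homogeneous of degree `0`, i.e. a morphism of `A-gmod`. -/
def IsDegZero {M N : GradedMod 𝒜} (f : M →ₗ[A] N) : Prop :=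
  ∀ (i : ℤ) (x : M), x ∈ M.deg i → f x ∈ N.deg i

/-- `M ≃ N`: there is an isomorphism of degree `0`. -/
def Iso (M N : GradedMod 𝒜) : Prop :=
  ∃ φ : M ≃ₗ[A] N, ∀ (i : ℤ) (x : M), x ∈ M.deg i ↔ φ x ∈ N.deg i

/-- The submodule `N` of `M`, graded by the subspaces `N ∩ M_i`, is isomorphic to `L` by an
isomorphism of degree `0`. (In particular `N` is then a graded submodule.) -/
def SubmoduleIso (M : GradedMod 𝒜) (N : Submodule A M) (L : GradedMod 𝒜) : Prop :=
  ∃ φ : N ≃ₗ[A] L, ∀ (i : ℤ) (x : N), (x : M) ∈ M.deg i ↔ φ x ∈ L.deg i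

/-- The shift `M⟨k⟩`, with `M⟨k⟩_d = M_{d-k}`. -/
def shift (M : GradedMod 𝒜) (k : ℤ) : GradedMod 𝒜 where
  carrier := M
  deg d := M.deg (d - k)
  isInternal := by
    have h := M.isInternal
    rw [DirectSum.isInternal_submodule_iff_iSupIndep_and_iSup_eq_top] at h ⊢
    refine ⟨h.1.comp (f := fun d : ℤ => d - k) (sub_left_injective), ?_⟩
    rw [← h.2]
    exact (Equiv.subRight k).iSup_comp (g := M.deg)
  smul_mem {i j a x} ha hx := by
    have := M.smul_mem ha hx
    rwa [← add_sub_assoc] at this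

/-- The largest degree in which `M` is nonzero (meaningful for `M ≠ 0`). -/
noncomputable def topDegree (M : GradedMod 𝒜) : ℤ := sSup {i | M.deg i ≠ ⊥}

/-- The smallest degree in which `M` is nonzero (meaningful for `M ≠ 0`). -/
noncomputable def botDegree (M : GradedMod 𝒜) : ℤ := sInf {i | M.deg i ≠ ⊥}

/-- The graded length `b - a + 1` of `M = M_a ⊕ ⋯ ⊕ M_b` with `M_a ≠ 0 ≠ M_b`. -/
noncomputable def gradedLength (M : GradedMod 𝒜) : ℤ := M.topDegree - M.botDegree + 1

theorem finite_setOf_deg_ne_bot (M : GradedMod 𝒜) : {i | M.deg i ≠ ⊥}.Finite :=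
  WellFoundedGT.finite_ne_bot_of_iSupIndep M.isInternal.submodule_iSupIndep

theorem setOf_deg_ne_bot_nonempty (M : GradedMod 𝒜) [Nontrivial M] :
    {i | M.deg i ≠ ⊥}.Nonempty := by
  by_contra h
  have h0 : ∀ i, M.deg i = ⊥ := by
    intro i
    by_contra hi
    exact h ⟨i, hi⟩
  have := M.isInternal.submodule_iSup_eq_top
  rw [iSup_congr h0, iSup_bot] at this
  obtain ⟨x, hx⟩ := exists_ne (0 : M)
  have hx' : x ∈ (⊥ : Submodule K M) := this ▸ Submodule.mem_top
  exact hx (by simpa using hx')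

/-- For `M ≠ 0` the top degree is attained and is the greatest degree of `M`. -/
theorem isGreatest_topDegree (M : GradedMod 𝒜) [Nontrivial M] :
    IsGreatest {i | M.deg i ≠ ⊥} M.topDegree :=
  ⟨Int.csSup_mem M.setOf_deg_ne_bot_nonempty M.finite_setOf_deg_ne_bot.bddAbove,
    fun _ hi => le_csSup M.finite_setOf_deg_ne_bot.bddAbove hi⟩

/-- For `M ≠ 0` the bottom degree is attained and is the least degree of `M`. -/
theorem isLeast_botDegree (M : GradedMod 𝒜) [Nontrivial M] :
    IsLeast {i | M.deg i ≠ ⊥} M.botDegree :=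
  ⟨Int.csInf_mem M.setOf_deg_ne_bot_nonempty M.finite_setOf_deg_ne_bot.bddBelow,
    fun _ hi => csInf_le M.finite_setOf_deg_ne_bot.bddBelow hi⟩

/-! ### The graded duality -/

section Dual

variable (star : GradedAntiInvolution 𝒜) (M : GradedMod 𝒜)

/-- The action `(a f)(m) = f(a^⋆ m)` of `A` on `Hom_K(M, K)`. -/
@[reducible] noncomputable def dualModule : Module A (Module.Dual K M) where
  smul a f := f ∘ₗ Algebra.lsmul K K M (star a)
  one_smul f := by
    ext x
    change f (star 1 • x) = f x
    rw [star.map_one, one_smul]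
  mul_smul a b f := by
    ext x
    change f (star (a * b) • x) = f (star b • star a • x)
    rw [star.map_mul, mul_smul]
  smul_zero a := by
    ext x
    rfl
  smul_add a f g := by
    ext x
    rfl
  add_smul a b f := by
    ext x
    change f (star (a + b) • x) = f (star a • x) + f (star b • x)
    rw [_root_.map_add, add_smul, _root_.map_add]
  zero_smul f := by
    ext x
    change f (star 0 • x) = 0
    rw [_root_.map_zero, zero_smul, _root_.map_zero]

/-- `(M^⊛)_j = Hom_K(M_{-j}, K)`: the linear forms vanishing on `M_i` for `i ≠ -j`. -/
def dualDeg (j : ℤ) : Submodule K (Module.Dual K M) where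
  carrier := {f | ∀ i : ℤ, i ≠ -j → ∀ x ∈ M.deg i, f x = 0}
  add_mem' {f g} hf hg i hi x hx := by simp [hf i hi x hx, hg i hi x hx]
  zero_mem' i _ x _ := rfl
  smul_mem' c f hf i hi x hx := by simp [hf i hi x hx]

theorem dualDeg_isInternal : DirectSum.IsInternal M.dualDeg := by
  classical
  rw [DirectSum.isInternal_submodule_iff_iSupIndep_and_iSup_eq_top]
  have htop := M.isInternal.submodule_iSup_eq_top
  have key : ∀ f : Module.Dual K M, (∀ i, ∀ x ∈ M.deg i, f x = 0) → f = 0 := by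
    intro f hf
    have : (⨆ i, M.deg i) ≤ LinearMap.ker f := iSup_le fun i x hx => hf i x hx
    rw [htop, top_le_iff, LinearMap.ker_eq_top] at this
    exact this
  constructor
  · rw [iSupIndep_def]
    intro j
    rw [Submodule.disjoint_def]
    intro f hf hf'
    apply key
    intro i x hx
    by_cases hi : i = -j
    · have hle : (⨆ k, ⨆ (_ : k ≠ j), M.dualDeg k) ≤
          LinearMap.ker (Module.Dual.eval K M x) := by
        refine iSup₂_le fun k hk g hg => ?_
        exact hg i (by omega) x hx
      exact hle hf'
    · exact hf i hi x hx
  · let _ := M.isInternal.chooseDecomposition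
    rw [eq_top_iff]
    intro f _
    set s : Finset ℤ := M.finite_setOf_deg_ne_bot.toFinset with hs
    let g : ℤ → Module.Dual K M := fun i =>
      f ∘ₗ (M.deg i).subtype ∘ₗ DirectSum.component K ℤ (fun i => M.deg i) i ∘ₗ
        (DirectSum.decomposeLinearEquiv M.deg).toLinearMap
    have hgx : ∀ i x, g i x = f (DirectSum.decompose M.deg x i) := fun i x => rfl
    have hsum : f = ∑ i ∈ s, g i := by
      rw [← sub_eq_zero]
      apply key
      intro i x hx
      rw [LinearMap.sub_apply, LinearMap.sum_apply]
      by_cases hi : i ∈ s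
      · rw [Finset.sum_eq_single i]
        · rw [hgx, DirectSum.decompose_of_mem_same _ hx, sub_self]
        · intro k _ hk
          rw [hgx, DirectSum.decompose_of_mem_ne _ hx hk.symm, _root_.map_zero]
        · exact fun h => absurd hi h
      · have h0 : M.deg i = ⊥ := by
          by_contra h
          exact hi (by simpa [hs] using h)
        rw [h0, Submodule.mem_bot] at hx
        simp [hx]
    rw [hsum]
    refine Submodule.sum_mem _ fun i _ => Submodule.mem_iSup_of_mem (-i) ?_
    intro k hk x hx
    rw [hgx, DirectSum.decompose_of_mem_ne _ hx (by omega), _root_.map_zero]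

/-- The dual graded module `M^⊛`. -/
noncomputable def dual : GradedMod 𝒜 :=
  letI := dualModule star M
  { carrier := Module.Dual K M
    tower := ⟨fun c a f => by
      ext x
      change f (star (c • a) • x) = c • f (star a • x)
      rw [LinearMap.map_smul, smul_assoc, LinearMap.map_smul]⟩
    deg := M.dualDeg
    isInternal := M.dualDeg_isInternal
    smul_mem := by
      intro i j a f ha hf k hk x hx
      exact hf (i + k) (by omega) _ (M.smul_mem (star.map_mem ha) hx) }

end Dual

/-! ### Socle, simple objects, projective covers -/

/-- The socle of a module, the sum of all its simple submodules (its largest semisimple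
submodule). -/
def socle (A M : Type*) [Ring A] [AddCommGroup M] [Module A M] : Submodule A M :=
  sSup {S : Submodule A M | IsSimpleModule A S}

/-- `N` is a graded submodule of `M`, i.e. `N = ⨁ (N ∩ M_i)`. -/
def IsGradedSubmodule (M : GradedMod 𝒜) (N : Submodule A M) : Prop :=
  N.restrictScalars K = ⨆ i : ℤ, N.restrictScalars K ⊓ M.deg i

/-- `M` is a simple object of `A-gmod`. -/
def IsGradedSimple (M : GradedMod 𝒜) : Prop :=
  Nontrivial M ∧ ∀ N : Submodule A M, M.IsGradedSubmodule N → N = ⊥ ∨ N = ⊤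

/-- `M` is an indecomposable object of `A-gmod`. -/
def IsGradedIndecomposable (M : GradedMod 𝒜) : Prop :=
  Nontrivial M ∧ ∀ N₁ N₂ : Submodule A M, M.IsGradedSubmodule N₁ → M.IsGradedSubmodule N₂ →
    IsCompl N₁ N₂ → N₁ = ⊥ ∨ N₂ = ⊥

/-- `M` has a finite filtration in `A-gmod` whose successive quotients satisfy `S`: either `M = 0`,
or there is a short exact sequence `0 → M' → M → M'' → 0` in `A-gmod` with `M'` filtered and
`M''` satisfying `S`. -/
inductive HasFiltration (S : GradedMod 𝒜 → Prop) : GradedMod 𝒜 → Prop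
  | zero (M : GradedMod 𝒜) : Subsingleton M → HasFiltration S M
  | step (M' M M'' : GradedMod 𝒜) (i : M' →ₗ[A] M) (p : M →ₗ[A] M'') :
      IsDegZero i → IsDegZero p → Function.Injective i → Function.Exact i p →
      Function.Surjective p → HasFiltration S M' → S M'' → HasFiltration S M

/-- `L` is a complete set of pairwise non-isomorphic simple `A`-modules, each of them graded by
being concentrated in degree `0`. -/
structure IsCompleteSetOfSimples {Λ : Type*} (L : Λ → GradedMod 𝒜) : Prop where
  simple : ∀ l, IsSimpleModule A (L l)
  deg_zero : ∀ l, (L l).deg 0 = ⊤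
  pairwise : ∀ l m, Nonempty (L l ≃ₗ[A] L m) → l = m
  complete : ∀ (S : Type u) [AddCommGroup S] [Module A S], IsSimpleModule A S →
    ∃ l, Nonempty (S ≃ₗ[A] L l)

/-- `P` is a graded lift of the projective cover of `L`, the covering map being of degree `0`: `P` is
projective and there is a surjection `P → L` of degree `0` with superfluous kernel. -/
def IsProjectiveCover (P L : GradedMod 𝒜) : Prop :=
  Module.Projective A P ∧ ∃ p : P →ₗ[A] L, IsDegZero p ∧ Function.Surjective p ∧
    ∀ N : Submodule A P, N ⊔ LinearMap.ker p = ⊤ → N = ⊤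

end GradedMod

open GradedMod

/-! ### Graded cellular algebras and graded highest weight categories -/

/-- A graded cell datum for the graded algebra `A`, whose cellular anti-involution is `star`. The
basis element `c ⟨x, s, t⟩` is `c^x_{st}`. -/
structure GradedCellDatum (𝒜 : ℤ → Submodule K A) (star : GradedAntiInvolution 𝒜) where
  X : Type u
  [partialOrder : PartialOrder X]
  T : X → Type u
  [fintype : ∀ x, Fintype (T x)]
  deg : ∀ x, T x → ℤ
  c : Module.Basis (Σ x, T x × T x) K A
  homogeneous : ∀ (x : X) (s t : T x), c ⟨x, s, t⟩ ∈ 𝒜 (deg x s + deg x t)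
  /-- The coefficients `r` do not depend on `s`; the congruence is modulo the span of the
  `c^y_{ab}` with `y > x`. -/
  mul : ∀ (x : X) (t : T x) (a : A), ∃ r : T x → K, ∀ s : T x,
    c ⟨x, s, t⟩ * a - ∑ v, r v • c ⟨x, s, v⟩ ∈
      Submodule.span K {b : A | ∃ y, x < y ∧ ∃ p : T y × T y, b = c ⟨y, p⟩}
  star_c : ∀ (x : X) (s t : T x), star (c ⟨x, s, t⟩) = c ⟨x, t, s⟩

/-- `A-gmod` with the standard objects `Δ l` (with heads `L l`) is a graded highest weight category
with the duality functor `⊛` given by `star`. -/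
structure IsGradedHighestWeight {𝒜 : ℤ → Submodule K A} (star : GradedAntiInvolution 𝒜)
    {Λ : Type*} [PartialOrder Λ] (L Δ : Λ → GradedMod 𝒜) : Prop where
  /-- `Δ l / rad (Δ l) ≃ L l`, and `L l` is simple. -/
  head : ∀ l, (L l).IsGradedSimple ∧ ∃ p : Δ l →ₗ[A] L l, IsDegZero p ∧ Function.Surjective p ∧
    LinearMap.ker p = Module.jacobson A (Δ l)
  self_dual : ∀ l, ((L l).dual star).Iso (L l)
  /-- The `(L l)⟨k⟩` form a complete set of pairwise non-isomorphic simple objects. -/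
  complete : ∀ S : GradedMod 𝒜, S.IsGradedSimple → ∃ (l : Λ) (k : ℤ), S.Iso ((L l).shift k)
  pairwise : ∀ (l m : Λ) (j k : ℤ), ((L l).shift j).Iso ((L m).shift k) → l = m ∧ j = k
  /-- If there is no nonzero morphism from any `(Δ l)⟨k⟩` to `M`, then `M = 0`. -/
  generate : ∀ M : GradedMod 𝒜,
    (∀ (l : Λ) (k : ℤ) (f : (Δ l).shift k →ₗ[A] M), IsDegZero f → f = 0) → Subsingleton M
  projective : ∀ l, ∃ (Q N : GradedMod 𝒜) (i : N →ₗ[A] Q) (f : Q →ₗ[A] Δ l),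
    Module.Projective A Q ∧ Q.IsGradedIndecomposable ∧
    IsDegZero i ∧ IsDegZero f ∧ Function.Injective i ∧ Function.Exact i f ∧
    Function.Surjective f ∧
    HasFiltration (fun D => ∃ (m : Λ) (k : ℤ), l < m ∧ D.Iso ((Δ m).shift k)) N
  /-- The endomorphism algebra of `Δ l` in `A-gmod` is `K`. -/
  endo : ∀ (l : Λ) (f : Δ l →ₗ[A] Δ l), IsDegZero f → ∃! c : K, ∀ x, f x = c • x
  le_of_hom : ∀ (l m : Λ) (f : Δ l →ₗ[A] Δ m), IsDegZero f → f ≠ 0 → l ≤ m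

/-! ### Blocks and double centralizers -/

/-- `c` is a block idempotent: a primitive idempotent of the centre of `A`. The blocks of `A`, i.e.
the indecomposable two-sided ideals of which `A` is the direct sum, are the ideals `c A`. -/
def IsBlockIdempotent {A : Type*} [Ring A] (c : A) : Prop :=
  c ∈ Set.center A ∧ IsIdempotentElem c ∧ c ≠ 0 ∧
    ∀ x ∈ Set.center A, IsIdempotentElem x → c * x = x → x = 0 ∨ x = c

/-- The `A`-modules `M` and `N` belong to the same block `c A`: `c` acts as the identity on both. -/
def InSameBlock (A M N : Type*) [Ring A] [AddCommGroup M] [Module A M] [AddCommGroup N]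
    [Module A N] : Prop :=
  ∃ c : A, IsBlockIdempotent c ∧ (∀ x : M, c • x = x) ∧ (∀ y : N, c • y = y)

/-- The double centralizer property on the `A`-module `Q`: the canonical map from `A` to the ring of
endomorphisms of `Q` commuting with `End_A(Q)` is an isomorphism. -/
def DoubleCentralizerProperty (A Q : Type*) [Ring A] [AddCommGroup Q] [Module A Q] : Prop :=
  Function.Bijective (Module.toModuleEnd (Module.End A Q) (S := A) Q)

end

/-!
The argument shows that the top degree is constant along nonzero homomorphisms between the
projective modules in question, and that the double centralizer property turns this into
constancy on blocks.

Write `P^l ≃ A ε_l` with `ε_l ∈ A_0` the components of `e`, and consider the finite set of degrees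
`S(l, m) = {i | ε_l A_i ε_m ≠ 0}`, the degrees of nonzero homogeneous maps `P^l → P^m`. Given
`0 ≠ x = ε_l a ε_m` with `a ∈ A_i`, the left ideal `A x ⊆ A ε_m` contains the simple socle
`L^m⟨d_m⟩`, on which `ε_m` acts nontrivially, so `ε_m b ε_l a ε_m ≠ 0` for some `b ∈ A_{d_m - i}`
(`GradedMod.GeneratingIdempotent.sub_mem_homDegrees`). Hence `i ∈ S(l, m)` implies
`d_m - i ∈ S(m, l)`, and applying this twice gives `i + (d_l - d_m) ∈ S(l, m)`. A nonempty finite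
set of integers is not stable under a nonzero translation, so `Hom(P^l, P^m) ≠ 0` forces
`d_l = d_m` (`GradedMod.GeneratingIdempotent.topDegree_eq`).

Consequently the projection of `A e ≃ ⨁ P^l` onto the sum of the `P^l` with `d_l = D` commutes with
every endomorphism of `A e`. By the double centralizer property it is the action of an element of
`A`, which is a central idempotent (`DoubleCentralizerProperty.exists_central_idempotent`). A central
idempotent cannot separate two simple modules of one block, whence `d_l = d_m`
(`InSameBlock.not_separated`). The bottom degree of every `P^l` is `0` because
`P^l` is generated in degree `0` and `A` is positively graded.
-/

namespace GradedMod

section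

variable {K A : Type u} [Field K] [Ring A] [Algebra K A] {𝒜 : ℤ → Submodule K A}

/-! ### Graded modules generated by a homogeneous idempotent -/

/-- An isomorphism of degree `0` from the graded module `M` onto a left ideal `A ε`, where `ε` is an
idempotent of degree `0`. It is encoded by the generator `gen` of `M` corresponding to `ε` and by the
linear map `toAlg : M → A`, with image `A ε`; that `ε` is idempotent follows from the fields. -/
structure GeneratingIdempotent (M : GradedMod 𝒜) where
  ε : A
  gen : M
  toAlg : M →ₗ[A] A
  ε_mem : ε ∈ 𝒜 0
  gen_mem : gen ∈ M.deg 0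
  toAlg_mem : ∀ {i : ℤ} {x : M}, x ∈ M.deg i → toAlg x ∈ 𝒜 i
  toAlg_gen : toAlg gen = ε
  toAlg_smul_gen : ∀ x : M, toAlg x • gen = x

namespace GeneratingIdempotent

variable {M N : GradedMod 𝒜}

theorem ε_smul_gen (g : GeneratingIdempotent M) : g.ε • g.gen = g.gen := by
  rw [← g.toAlg_gen, g.toAlg_smul_gen]

theorem toAlg_injective (g : GeneratingIdempotent M) : Function.Injective g.toAlg := by
  intro x y h
  rw [← g.toAlg_smul_gen x, h, g.toAlg_smul_gen]

theorem map_gen_ne_zero {N : Type*} [AddCommGroup N] [Module A N] (g : GeneratingIdempotent M)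
    {f : M →ₗ[A] N} (hf : f ≠ 0) : f g.gen ≠ 0 := by
  intro h
  apply hf
  ext x
  rw [← g.toAlg_smul_gen x, map_smul, h, smul_zero, LinearMap.zero_apply]

theorem gen_ne_zero [Nontrivial M] (g : GeneratingIdempotent M) : g.gen ≠ 0 :=
  g.map_gen_ne_zero (f := LinearMap.id) fun h => by
    obtain ⟨x, hx⟩ := exists_ne (0 : M)
    exact hx (LinearMap.congr_fun h x)

theorem botDegree_eq_zero [Nontrivial M] (g : GeneratingIdempotent M)
    (hpos : ∀ i : ℤ, i < 0 → 𝒜 i = ⊥) : M.botDegree = 0 := by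
  refine M.isLeast_botDegree.unique ⟨?_, fun i hi => ?_⟩
  · exact fun h => g.gen_ne_zero ((Submodule.mem_bot K).1 (h ▸ g.gen_mem))
  · by_contra hneg
    refine hi ((Submodule.eq_bot_iff _).2 fun x hx => g.toAlg_injective ?_)
    have := g.toAlg_mem hx
    rwa [hpos i (not_le.1 hneg), Submodule.mem_bot, ← map_zero g.toAlg] at this

/-! ### Degrees of homomorphisms and the socle -/

/-- The degrees `i` with `ε A_i ε' ≠ 0`, i.e. the degrees of the nonzero homogeneous maps
`A ε → A ε'`. -/
def homDegrees (g : GeneratingIdempotent M) (h : GeneratingIdempotent N) : Set ℤ :=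
  {i | ∃ a ∈ 𝒜 i, g.ε * a * h.ε ≠ 0}

theorem homDegrees_finite [GradedAlgebra 𝒜] [FiniteDimensional K A]
    (g : GeneratingIdempotent M) (h : GeneratingIdempotent N) : (g.homDegrees h).Finite := by
  refine (WellFoundedGT.finite_ne_bot_of_iSupIndep
    (DirectSum.Decomposition.isInternal 𝒜).submodule_iSupIndep).subset ?_
  rintro i ⟨a, ha, hne⟩ hbot
  rw [hbot, Submodule.mem_bot] at ha
  simp [ha] at hne

theorem homDegrees_nonempty [GradedAlgebra 𝒜] (g : GeneratingIdempotent M)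
    (h : GeneratingIdempotent N) {f : M →ₗ[A] N} (hf : f ≠ 0) : (g.homDegrees h).Nonempty := by
  classical
  by_contra hempty
  have hzero : ∀ a : A, g.ε * a * h.ε = 0 := by
    intro a
    induction a using DirectSum.Decomposition.inductionOn 𝒜 with
    | zero => simp
    | @homogeneous i a =>
      by_contra hne
      exact hempty ⟨i, a, a.2, hne⟩
    | add a b ha hb => rw [mul_add, add_mul, ha, hb, add_zero]
  refine g.map_gen_ne_zero hf (h.toAlg_injective ?_)
  rw [← g.ε_smul_gen, map_smul, ← h.toAlg_smul_gen (f g.gen), map_smul, map_smul, h.toAlg_gen,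
    smul_eq_mul, smul_eq_mul, ← mul_assoc, hzero, map_zero]

end GeneratingIdempotent

theorem socle_le_of_ne_bot {M : GradedMod 𝒜} (hs : IsSimpleModule A (socle A M))
    {N : Submodule A M} (hN : N ≠ ⊥) : socle A M ≤ N := by
  have : IsArtinian A M := isArtinian_of_tower K inferInstance
  obtain ⟨T, hT, hTN⟩ := (eq_bot_or_exists_atom_le N).resolve_left hN
  have hTs : T ≤ socle A M := le_sSup (isSimpleModule_iff_isAtom.2 hT)
  rwa [← ((isSimpleModule_iff_isAtom.1 hs).le_iff_eq hT.1).1 hTs]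

namespace GeneratingIdempotent

variable {M N : GradedMod 𝒜}

/-- If the socle of `N ≃ A ε'` is its simple head shifted by `d`, then every nonzero map
`A ε → A ε'` of degree `i` can be completed to a map `A ε' → A ε → A ε'` of degree `d` hitting the
socle. -/
theorem sub_mem_homDegrees [GradedAlgebra 𝒜] (g : GeneratingIdempotent M)
    (h : GeneratingIdempotent N) {L : GradedMod 𝒜} (hL : IsSimpleModule A L)
    (hL0 : L.deg 0 = ⊤) {p : N →ₗ[A] L} (hp : p ≠ 0) {d : ℤ}
    (hsoc : N.SubmoduleIso (socle A N) (L.shift d)) {i : ℤ} (hi : i ∈ g.homDegrees h) :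
    d - i ∈ h.homDegrees g := by
  obtain ⟨a, ha, hne⟩ := hi
  obtain ⟨φ, hφ⟩ := hsoc
  have hsimple : IsSimpleModule A (socle A N) :=
    have : IsSimpleModule A (L.shift d) := hL
    IsSimpleModule.congr φ
  set x : N := (g.ε * a) • h.gen with hx
  have hax : h.toAlg x = g.ε * a * h.ε := by
    rw [hx, map_smul, h.toAlg_gen, smul_eq_mul]
  have hx0 : x ≠ 0 := fun h0 => hne (by rw [← hax, h0, map_zero])
  have hle : socle A N ≤ Submodule.span A {x} :=
    socle_le_of_ne_bot hsimple (by simpa using hx0)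
  -- an element of the socle on which `ε'` acts nontrivially
  let y : L.shift d := p h.gen
  let s := φ.symm y
  have hys : h.ε • y = y := (map_smul p _ _).symm.trans (congrArg p h.ε_smul_gen)
  have hεs : h.ε • (s : N) ≠ 0 := by
    have hs : h.ε • s = s := by rw [← map_smul, hys]
    rw [← Submodule.coe_smul, hs]
    intro h0
    have : y = 0 := φ.symm.map_eq_zero_iff.1 (Subtype.ext h0)
    exact h.map_gen_ne_zero hp this
  have hsd : (s : N) ∈ N.deg d := by
    rw [hφ d s]
    change φ s ∈ L.deg (d - d)
    rw [sub_self, hL0]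
    trivial
  obtain ⟨b, hb⟩ := Submodule.mem_span_singleton.1 (hle s.2)
  have hmem : g.ε * a * h.ε ∈ 𝒜 i := by
    have := SetLike.mul_mem_graded (SetLike.mul_mem_graded g.ε_mem ha) h.ε_mem
    rwa [zero_add, add_zero] at this
  have hbs : h.toAlg s = b * (g.ε * a * h.ε) := by
    rw [← hb, map_smul, hax, smul_eq_mul]
  -- only the component of `b` in degree `d - i` contributes
  have hcomp : h.toAlg s = (DirectSum.decompose 𝒜 b (d - i) : A) * (g.ε * a * h.ε) := by
    rw [← DirectSum.coe_decompose_mul_add_of_right_mem 𝒜 hmem, ← hbs, sub_add_cancel,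
      DirectSum.decompose_of_mem_same 𝒜 (h.toAlg_mem hsd)]
  refine ⟨_, (DirectSum.decompose 𝒜 b (d - i)).2, fun h0 => hεs (h.toAlg_injective ?_)⟩
  rw [map_smul, hcomp, smul_eq_mul, map_zero]
  simp only [← mul_assoc]
  rw [h0, zero_mul, zero_mul]

theorem topDegree_eq [GradedAlgebra 𝒜] [FiniteDimensional K A] (g : GeneratingIdempotent M)
    (h : GeneratingIdempotent N) {L L' : GradedMod 𝒜} (hL : IsSimpleModule A L)
    (hL' : IsSimpleModule A L') (hL0 : L.deg 0 = ⊤) (hL0' : L'.deg 0 = ⊤) {p : M →ₗ[A] L}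
    {p' : N →ₗ[A] L'} (hp : p ≠ 0) (hp' : p' ≠ 0)
    (hsoc : M.SubmoduleIso (socle A M) (L.shift M.topDegree))
    (hsoc' : N.SubmoduleIso (socle A N) (L'.shift N.topDegree)) {f : M →ₗ[A] N} (hf : f ≠ 0) :
    M.topDegree = N.topDegree := by
  have hfin := g.homDegrees_finite h
  have hnon := g.homDegrees_nonempty h hf
  have hstep : ∀ i ∈ g.homDegrees h, M.topDegree - (N.topDegree - i) ∈ g.homDegrees h :=
    fun i hi => h.sub_mem_homDegrees g hL hL0 hp hsoc
      (g.sub_mem_homDegrees h hL' hL0' hp' hsoc' hi)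
  -- a nonempty finite set is stable under translation only by `0`
  have hmax := hstep _ (Int.csSup_mem hnon hfin.bddAbove)
  have hmin := hstep _ (Int.csInf_mem hnon hfin.bddBelow)
  have h₁ := le_csSup hfin.bddAbove hmax
  have h₂ := csInf_le hfin.bddBelow hmin
  omega

/-- If a left ideal generated by an idempotent `e` of degree `0` is a direct sum of graded modules,
then each summand is generated by an idempotent, namely by the corresponding component of `e`. -/
noncomputable def ofDirectSum {ι : Type*} {P : ι → GradedMod 𝒜} {e : A}
    (he : IsIdempotentElem e) (he0 : e ∈ 𝒜 0)
    (φ : (Ideal.span {e} : Ideal A) ≃ₗ[A] ((l : ι) → P l))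
    (hφ : ∀ (i : ℤ) (x : (Ideal.span {e} : Ideal A)),
      (x : A) ∈ 𝒜 i ↔ ∀ l, φ x l ∈ (P l).deg i) (l : ι) : GeneratingIdempotent (P l) := by
  classical
  exact
  let e' : (Ideal.span {e} : Ideal A) := ⟨e, Ideal.subset_span rfl⟩
  let ψ : P l →ₗ[A] A :=
    (Ideal.span {e} : Ideal A).subtype ∘ₗ φ.symm.toLinearMap ∘ₗ LinearMap.single A (fun l => P l) l
  have hψ : ∀ {i : ℤ} {x : P l}, x ∈ (P l).deg i → ψ x ∈ 𝒜 i := by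
    intro i x hx
    refine (hφ i _).2 fun k => ?_
    change φ (φ.symm (Pi.single l x)) k ∈ _
    rw [φ.apply_symm_apply]
    by_cases hk : k = l
    · subst hk
      rwa [Pi.single_eq_same]
    · rw [Pi.single_eq_of_ne hk]
      exact zero_mem _
  have hgen : φ e' l ∈ (P l).deg 0 := (hφ 0 e').1 he0 l
  { ε := ψ (φ e' l)
    gen := φ e' l
    toAlg := ψ
    ε_mem := hψ hgen
    gen_mem := hgen
    toAlg_mem := hψ
    toAlg_gen := rfl
    toAlg_smul_gen := fun x => by
      have hmul : ψ x • e' = φ.symm (Pi.single l x) := by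
        obtain ⟨b, hb⟩ := Ideal.mem_span_singleton'.1 (φ.symm (Pi.single l x)).2
        apply Subtype.ext
        change ((φ.symm (Pi.single l x) : (Ideal.span {e} : Ideal A)) : A) * e = _
        rw [← hb, mul_assoc, he.eq]
      rw [← Pi.smul_apply, ← map_smul, hmul, φ.apply_symm_apply, Pi.single_eq_same] }

end GeneratingIdempotent

end

end GradedMod

/-! ### Double centralizers and blocks -/

/-- A set `s` of summands of `Q ≃ ⨁ P l` admitting no nonzero homomorphisms to or from the other
summands is cut out by a central idempotent of `A`, if `Q` has the double centralizer property. -/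
theorem DoubleCentralizerProperty.exists_central_idempotent {A Q ι : Type*} [Ring A]
    [AddCommGroup Q] [Module A Q] (hQ : DoubleCentralizerProperty A Q) {P : ι → Type*}
    [∀ l, AddCommGroup (P l)] [∀ l, Module A (P l)] [Finite ι] (φ : Q ≃ₗ[A] ((l : ι) → P l))
    (s : Set ι) (hs : ∀ l m, ¬(l ∈ s ↔ m ∈ s) → ∀ f : P l →ₗ[A] P m, f = 0) :
    ∃ z ∈ Set.center A, IsIdempotentElem z ∧ (∀ l ∈ s, ∀ x : P l, z • x = x) ∧
      ∀ l ∉ s, ∀ x : P l, z • x = 0 := by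
  classical
  have := Fintype.ofFinite ι
  let cut : ((l : ι) → P l) →ₗ[A] ((l : ι) → P l) :=
    LinearMap.pi fun l => if l ∈ s then LinearMap.proj l else 0
  have hcut : ∀ x l, cut x l = if l ∈ s then x l else 0 := by
    intro x l
    change (if l ∈ s then LinearMap.proj l else 0 : ((l : ι) → P l) →ₗ[A] P l) x = _
    split_ifs <;> rfl
  have hcomm : ∀ (f : ((l : ι) → P l) →ₗ[A] ((l : ι) → P l)), cut ∘ₗ f = f ∘ₗ cut := by
    intro f
    refine LinearMap.pi_ext fun l x => funext fun m => ?_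
    rw [LinearMap.comp_apply, LinearMap.comp_apply, hcut]
    have hsingle : cut (Pi.single l x) = if l ∈ s then Pi.single l x else 0 := by
      funext k
      rw [hcut]
      by_cases hk : k = l
      · subst hk
        split_ifs <;> simp
      · split_ifs <;> simp [Pi.single_eq_of_ne hk]
    rw [hsingle]
    by_cases hlm : l ∈ s ↔ m ∈ s
    · by_cases hm : m ∈ s
      · rw [if_pos hm, if_pos (hlm.2 hm)]
      · rw [if_neg hm, if_neg (mt hlm.1 hm), map_zero, Pi.zero_apply]
    · have hz : f (Pi.single l x) m = 0 :=
        LinearMap.congr_fun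
          (hs l m hlm (LinearMap.proj m ∘ₗ f ∘ₗ LinearMap.single A P l)) x
      split_ifs <;> simp [hz]
  let π : Q →ₗ[A] Q := φ.symm.toLinearMap ∘ₗ cut ∘ₗ φ.toLinearMap
  have hφπ : ∀ x, φ (π x) = cut (φ x) := fun x => φ.apply_symm_apply _
  have hπcomm : ∀ (f : Module.End A Q) (x : Q), π (f x) = f (π x) := by
    intro f x
    apply φ.injective
    rw [hφπ]
    have := LinearMap.congr_fun (hcomm (φ.toLinearMap ∘ₗ f ∘ₗ φ.symm.toLinearMap)) (φ x)
    simpa [π] using this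
  obtain ⟨z, hz⟩ := hQ.2
    { toFun := π, map_add' := map_add π, map_smul' := hπcomm : Module.End (Module.End A Q) Q }
  have hzx : ∀ x : Q, z • x = π x := fun x => LinearMap.congr_fun hz x
  have hfaith : ∀ a b : A, (∀ x : Q, a • x = b • x) → a = b :=
    fun a b hab => hQ.1 (LinearMap.ext hab)
  have hzP : ∀ (l : ι) (x : P l), z • x = if l ∈ s then x else 0 := by
    intro l x
    have h := congrFun (hφπ (φ.symm (Pi.single l x))) l
    rw [← hzx, map_smul, hcut, φ.apply_symm_apply, Pi.smul_apply, Pi.single_eq_same] at h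
    exact h
  refine ⟨z, ?_, ?_, fun l hl x => by rw [hzP, if_pos hl], fun l hl x => by rw [hzP, if_neg hl]⟩
  · rw [Semigroup.mem_center_iff]
    intro a
    refine hfaith _ _ fun x => ?_
    rw [mul_smul, mul_smul, hzx, hzx, map_smul]
  · refine hfaith _ _ fun x => φ.injective (funext fun l => ?_)
    rw [mul_smul, hzx, hzx, hφπ, hφπ, hcut, hcut]
    split_ifs <;> rfl

/-- A central idempotent does not act as the identity on one nonzero module of a block and as `0` on
another one. -/
theorem InSameBlock.not_separated {A M N : Type*} [Ring A] [AddCommGroup M] [Module A M]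
    [AddCommGroup N] [Module A N] [Nontrivial M] [Nontrivial N] (h : InSameBlock A M N) {z : A}
    (hz : z ∈ Set.center A) (hz' : IsIdempotentElem z) (hM : ∀ x : M, z • x = x)
    (hN : ∀ x : N, z • x = 0) : False := by
  obtain ⟨c, ⟨hc, hcc, -, hprim⟩, hcM, hcN⟩ := h
  have hidem : IsIdempotentElem (c * z) :=
    hcc.mul_of_commute (Semigroup.mem_center_iff.1 hz c) hz'
  obtain h0 | h1 := hprim (c * z) (Set.mul_mem_center hc hz) hidem (by rw [← mul_assoc, hcc.eq])
  · obtain ⟨x, hx⟩ := exists_ne (0 : M)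
    apply hx
    rw [← hcM x, ← hM x, ← mul_smul, h0, zero_smul]
  · obtain ⟨y, hy⟩ := exists_ne (0 : N)
    apply hy
    rw [← hcN y, ← h1, mul_smul, hN, smul_zero]

/-! ### Constancy of the top degree on blocks -/

theorem proposition3p11 {K A : Type u} [Field K] [IsAlgClosed K] [Ring A] [Algebra K A]
    [FiniteDimensional K A]
    -- `A` is positively graded, with a homogeneous anti-involution of degree `0`
    (𝒜 : ℤ → Submodule K A) [GradedAlgebra 𝒜] (hpos : ∀ i : ℤ, i < 0 → 𝒜 i = ⊥)
    (star : GradedAntiInvolution 𝒜)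
    -- the simple modules and their projective covers
    {Λ : Type*} [Finite Λ] (L P : Λ → GradedMod 𝒜)
    (hL : GradedMod.IsCompleteSetOfSimples L)
    (hP : ∀ l, (P l).IsProjectiveCover (L l))
    -- the socle condition, for `l ∈ Λ₀`, i.e. `P l` injective
    (hsoc : ∀ l, Module.Injective A (P l) →
      (P l).SubmoduleIso (GradedMod.socle A (P l)) ((L l).shift (P l).topDegree))
    -- graded cellular, or graded highest weight with duality
    (hA : Nonempty (GradedCellDatum 𝒜 star) ∨
      ∃ (_ : PartialOrder Λ) (Δ : Λ → GradedMod 𝒜), IsGradedHighestWeight star L Δ)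
    -- the idempotent `e`; `Ideal.span {e}` is the left ideal `A e`
    (e : A) (he : IsIdempotentElem e) (he0 : e ∈ 𝒜 0) (hestar : star e = e)
    (hAe : ∃ φ : (Ideal.span {e} : Ideal A) ≃ₗ[A]
        ((l : {l : Λ // Module.Injective A (P l)}) → P l.1),
      ∀ (i : ℤ) (x : (Ideal.span {e} : Ideal A)),
        (x : A) ∈ 𝒜 i ↔ ∀ l, φ x l ∈ (P l.1).deg i)
    (hdc : DoubleCentralizerProperty A (Ideal.span {e} : Ideal A)) :
    ∀ l m : Λ, Module.Injective A (P l) → Module.Injective A (P m) →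
      InSameBlock A (L l) (L m) →
      (P l).topDegree = (P m).topDegree ∧ (P l).gradedLength = (P m).gradedLength := by
  obtain ⟨φ, hφ⟩ := hAe
  let g := GradedMod.GeneratingIdempotent.ofDirectSum
    (P := fun l : {l : Λ // Module.Injective A (P l)} => P l.1) he he0 φ hφ
  have hcover : ∀ l, ∃ p : P l →ₗ[A] L l, Function.Surjective p ∧ p ≠ 0 := by
    intro l
    obtain ⟨-, p, -, hp, -⟩ := hP l
    have := hL.simple l
    have := IsSimpleModule.nontrivial A (L l)
    refine ⟨p, hp, ?_⟩
    rintro rfl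
    obtain ⟨y, hy⟩ := exists_ne (0 : L l)
    obtain ⟨x, rfl⟩ := hp y
    exact hy rfl
  have hlink : ∀ (l m : {l : Λ // Module.Injective A (P l)}) (f : P l.1 →ₗ[A] P m.1), f ≠ 0 →
      (P l.1).topDegree = (P m.1).topDegree := by
    intro l m f hf
    obtain ⟨p, -, hp⟩ := hcover l.1
    obtain ⟨q, -, hq⟩ := hcover m.1
    exact (g l).topDegree_eq (g m) (hL.simple _) (hL.simple _) (hL.deg_zero _) (hL.deg_zero _) hp hq
      (hsoc _ l.2) (hsoc _ m.2) hf
  intro l m hl hm hblock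
  have := hL.simple l
  have := IsSimpleModule.nontrivial A (L l)
  have := hL.simple m
  have := IsSimpleModule.nontrivial A (L m)
  obtain ⟨p, hp, -⟩ := hcover l
  obtain ⟨q, hq, -⟩ := hcover m
  have htop : (P l).topDegree = (P m).topDegree := by
    by_contra hne
    obtain ⟨z, hz, hzz, hzone, hzzero⟩ := hdc.exists_central_idempotent φ
      {k | (P k.1).topDegree = (P l).topDegree} (fun k k' hkk' f => by
        by_contra hf
        exact hkk' (by rw [Set.mem_ofPred_eq, Set.mem_ofPred_eq, hlink k k' f hf]))
    refine hblock.not_separated hz hzz (fun y => ?_) (fun y => ?_)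
    · obtain ⟨x, rfl⟩ := hp y
      rw [← map_smul, hzone ⟨l, hl⟩ rfl x]
    · obtain ⟨x, rfl⟩ := hq y
      rw [← map_smul, hzzero ⟨m, hm⟩ (Ne.symm hne) x, map_zero]
  have : Nontrivial (P l) := hp.nontrivial
  have : Nontrivial (P m) := hq.nontrivial
  refine ⟨htop, ?_⟩
  rw [GradedMod.gradedLength, GradedMod.gradedLength, htop, (g ⟨l, hl⟩).botDegree_eq_zero hpos,
    (g ⟨m, hm⟩).botDegree_eq_zero hpos]
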